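/- All signals are functions on $[0,\infty)$, identified when equal almost everywhere; $\mathcal L_2$ is the space of square-integrable signals, $\mathcal L_{2e}$ that of signals square-integrable on every $[0,T]$; $\langle a,b\rangle=\int_0^\infty a(t)^\top b(t)\,dt$ and $\|a\|=\sqrt{\langle a,a\rangle}$. For $i=1,2$ let subsystem $i$ be a system $\dot x_i=f_i(x_i,u_i)$, $x_i(0)=0$, $y_i=g_i(x_i,u_i)$, with state $x_i(t)\in\mathbb R^{n_i}$, scalar input $u_i$ and scalar output $y_i$, $f_i(0,0)=0$, $g_i(0,0)=0$, whose solutions are absolutely continuous and satisfy the differential equation almost everywhere. Assume that for every $u_i\in\mathcal L_{2e}$ a solution exists on $[0,\infty)$, and that every $u_i\in\mathcal L_2$ is mapped to states and outputs $x_i,y_i\in\mathcal L_2$. Let $\Theta_i,\Pi_i\in\mathbb R^{2\times2}$ be symmetric, $\varepsilon_i\in\mathbb R$ and $\Psi_{\varepsilon}=\begin{bmatrix}2\varepsilon&1\\1&0\end{bmatrix}$. Subsystem $i$ is called mixed dissipative (with $\Theta_i,\Pi_i,\varepsilon_i$) if each of its input-output pairs $\xi=[u_i,y_i]^\top$ with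 $u_i\in\mathcal L_2$ satisfies $0\le\langle\xi,\Theta_i\xi\rangle$, or both $0\le\langle\xi,\Psi_{\varepsilon_i}\xi\rangle$ and $0\le\langle\xi,\Pi_i\xi\rangle$ (or all three). It is called finite-gain mixed dissipative if, in addition, $(\Theta_i)_{11}\ge0$, $(\Theta_i)_{22}<0$, $(\Pi_i)_{11}\ge0$ and $(\Pi_i)_{22}<0$. For $\tau\in[0,1]$ consider the negative feedback interconnection with loop gain $\tau$, given by $u_1=w_1-\tau y_2$ and $u_2=w_2+y_1$, with external input $w=(w_1,w_2)$ and output $y=(y_1,y_2)$. It is called well-posed if for all $w_1,w_2\in\mathcal L_{2e}$ there exist outputs $y_1,y_2\in\mathcal L_{2e}$, and the outputs depend causally on $w$: if two inputs $w,w'\in\mathcal L_{2e}$ agree on $[0,T]$, then for every output $y\in\mathcal L_{2e}$ for $w$ there is an output $y'\in\mathcal L_{2e}$ for $w'$ that agrees with $y$ on $[0,T]$. (Outputs need not be unique; if they are, this says that $w\mapsto y$ is a causal map.) **Theorem.** Suppose that subsystem 1 is finite-gain mixed dissipative with $\varepsilon_1\le0$, that subsystem 2 is mixed dissipative with $\varepsilon_2<0$,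 and that the interconnection with loop gain $\tau$ is well-posed for every $\tau\in[0,1]$. Let $M=\begin{bmatrix}0&-1\\1&0\end{bmatrix}$. If there are $p_1,p_2,p_3\ge0$ such that $$M^\top\Theta_1M+p_1\Pi_2\prec0,\qquad M^\top\Pi_1M+p_2\Theta_2\prec0,\qquad M^\top\Theta_1M+p_3\Theta_2\prec0,$$ then the interconnection with $\tau=1$ maps $w\in\mathcal L_2$ to $y\in\mathcal L_2$, with finite gain: there is $\gamma>0$ such that for all $w_1,w_2\in\mathcal L_2$ outputs $y\in\mathcal L_{2e}$ exist, and every such output lies in $\mathcal L_2$ and satisfies $\|y\|\le\gamma\|w\|$. -/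

import Mathlib

open MeasureTheory Set Matrix

noncomputable section

/-- Real-valued signals on `[0, ∞)` are functions `ℝ → ℝ` of which only the values at times
`t ≥ 0` matter; `IsL2 u` says that `u` is square integrable on `[0, ∞)`. -/
def IsL2 {E : Type*} [NormedAddCommGroup E] (u : ℝ → E) : Prop :=
  MemLp u 2 (volume.restrict (Ici 0))

/-- `u` is square integrable on every finite interval `[0, T]`. -/
def IsL2e {E : Type*} [NormedAddCommGroup E] (u : ℝ → E) : Prop :=
  ∀ T : ℝ, 0 ≤ T → MemLp u 2 (volume.restrict (Icc 0 T))

/-- Two signals agree (almost everywhere) on `[0, T]`. -/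
def AgreeUpTo (T : ℝ) (u v : ℝ → ℝ) : Prop :=
  ∀ᵐ t ∂(volume.restrict (Icc 0 T)), u t = v t

/-- The `L2` norm on `[0, ∞)` of the two-component signal `(a, b)`. -/
def pairNorm (a b : ℝ → ℝ) : ℝ :=
  Real.sqrt (∫ t in Ici (0 : ℝ), (a t ^ 2 + b t ^ 2))

/-- The integral `⟨ξ, P ξ⟩` over `[0, ∞)` for the signal `ξ = (u, y)`. -/
def supply (P : Matrix (Fin 2) (Fin 2) ℝ) (u y : ℝ → ℝ) : ℝ :=
  ∫ t in Ici (0 : ℝ), ![u t, y t] ⬝ᵥ (P *ᵥ ![u t, y t])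

/-- The system `ẋ = f(x, u)`, `y = g(x, u)` with state in `ℝⁿ`, scalar input and scalar output,
and with `f(0,0) = 0` and `g(0,0) = 0`. -/
structure NonlinearSystem where
  n : ℕ
  f : EuclideanSpace ℝ (Fin n) → ℝ → EuclideanSpace ℝ (Fin n)
  g : EuclideanSpace ℝ (Fin n) → ℝ → ℝ
  f_zero : f 0 0 = 0
  g_zero : g 0 0 = 0

namespace NonlinearSystem

/-- `x` is a solution on `[0, ∞)`, with input `u`, starting at the origin: absolutely continuous
on every `[0, T]`, and satisfying the differential equation at almost all times. -/
def IsSolution (S : NonlinearSystem) (u : ℝ → ℝ) (x : ℝ → EuclideanSpace ℝ (Fin S.n)) : Prop :=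
  x 0 = 0 ∧
  (∀ T : ℝ, 0 ≤ T → AbsolutelyContinuousOnInterval x 0 T) ∧
  ∀ᵐ t ∂(volume.restrict (Ici (0 : ℝ))), HasDerivAt x (S.f (x t) (u t)) t

/-- `y` is the output along the solution `x` with input `u`. -/
def IsOutput (S : NonlinearSystem) (u : ℝ → ℝ) (x : ℝ → EuclideanSpace ℝ (Fin S.n))
    (y : ℝ → ℝ) : Prop :=
  ∀ᵐ t ∂(volume.restrict (Ici (0 : ℝ))), y t = S.g (x t) (u t)

/-- `(u, y)` is an input-output pair of the system. -/
def IsIOPair (S : NonlinearSystem) (u y : ℝ → ℝ) : Prop :=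
  ∃ x : ℝ → EuclideanSpace ℝ (Fin S.n), S.IsSolution u x ∧ S.IsOutput u x y

/-- Every input in `L2e` has a solution that exists for all times. -/
def HasGlobalSolutions (S : NonlinearSystem) : Prop :=
  ∀ u : ℝ → ℝ, IsL2e u → ∃ x, S.IsSolution u x

/-- Inputs in `L2` are mapped to states and outputs in `L2`. -/
def IsL2Stable (S : NonlinearSystem) : Prop :=
  ∀ (u : ℝ → ℝ) (x : ℝ → EuclideanSpace ℝ (Fin S.n)) (y : ℝ → ℝ),
    IsL2 u → S.IsSolution u x → S.IsOutput u x y → IsL2 x ∧ IsL2 y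

/-- The matrix `Ψ_ε`. -/
def PsiMatrix (ε : ℝ) : Matrix (Fin 2) (Fin 2) ℝ := !![2 * ε, 1; 1, 0]

/-- Mixed dissipativity with respect to the symmetric matrices `Θ`, `PiM` and the constant `ε`:
each square-integrable input-output pair satisfies the first inequality or both of the others. (`PiM` stands for `Π`, which Lean reserves.) -/
def IsMixedDissipative (S : NonlinearSystem) (Θ PiM : Matrix (Fin 2) (Fin 2) ℝ) (ε : ℝ) : Prop :=
  Θ.IsSymm ∧ PiM.IsSymm ∧
  ∀ u y : ℝ → ℝ, IsL2 u → IsL2 y → S.IsIOPair u y →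
    0 ≤ supply Θ u y ∨ (0 ≤ supply (PsiMatrix ε) u y ∧ 0 ≤ supply PiM u y)

/-- Finite-gain mixed dissipativity. -/
def IsFiniteGainMixedDissipative (S : NonlinearSystem) (Θ PiM : Matrix (Fin 2) (Fin 2) ℝ)
    (ε : ℝ) : Prop :=
  S.IsMixedDissipative Θ PiM ε ∧ (0 ≤ Θ 0 0 ∧ Θ 1 1 < 0) ∧ (0 ≤ PiM 0 0 ∧ PiM 1 1 < 0)

end NonlinearSystem

/-- `y₁, y₂` in `L2e` are outputs of the negative feedback interconnection with loop gain `τ`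
for the external inputs `w₁, w₂`, that is, `u₁ = w₁ - τ y₂`, `u₂ = w₂ + y₁`, and each
`(uᵢ, yᵢ)` is an input-output pair of subsystem `i`. -/
def IsClosedLoopOutput (S₁ S₂ : NonlinearSystem) (τ : ℝ) (w₁ w₂ y₁ y₂ : ℝ → ℝ) : Prop :=
  IsL2e y₁ ∧ IsL2e y₂ ∧
  S₁.IsIOPair (fun t => w₁ t - τ * y₂ t) y₁ ∧
  S₂.IsIOPair (fun t => w₂ t + y₁ t) y₂

/-- Well-posedness of the interconnection with loop gain `τ`: all `w₁, w₂` in `L2e` admit outputs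
`y₁, y₂` in `L2e`, and the outputs depend causally on the inputs: if two inputs agree on `[0, T]`,
then the outputs that they admit agree on `[0, T]`. Uniqueness of the outputs is not required, so
that the last clause is stated for the set of outputs; when they are unique, it is the usual
causality of the map from `w` to `y`. -/
def IsWellPosed (S₁ S₂ : NonlinearSystem) (τ : ℝ) : Prop :=
  (∀ w₁ w₂ : ℝ → ℝ, IsL2e w₁ → IsL2e w₂ → ∃ y₁ y₂, IsClosedLoopOutput S₁ S₂ τ w₁ w₂ y₁ y₂) ∧
  ∀ (T : ℝ), 0 ≤ T → ∀ w₁ w₂ v₁ v₂ y₁ y₂ : ℝ → ℝ,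
    IsL2e w₁ → IsL2e w₂ → IsL2e v₁ → IsL2e v₂ →
    AgreeUpTo T w₁ v₁ → AgreeUpTo T w₂ v₂ → IsClosedLoopOutput S₁ S₂ τ w₁ w₂ y₁ y₂ →
    ∃ z₁ z₂, IsClosedLoopOutput S₁ S₂ τ v₁ v₂ z₁ z₂ ∧ AgreeUpTo T y₁ z₁ ∧ AgreeUpTo T y₂ z₂

/-- The matrix `M`. -/
def loopMatrix : Matrix (Fin 2) (Fin 2) ℝ := !![0, -1; 1, 0]

/-- Negative definiteness of a symmetric matrix. -/
def NegDef (P : Matrix (Fin 2) (Fin 2) ℝ) : Prop := (-P).PosDef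

end

/-!
The proof has two halves: an `L2` gain bound for those responses that are known to be square
integrable, uniform in the loop gain `τ ∈ [0, 1]`, and a continuation in `τ` from the open cascade
`τ = 0` to `τ = 1`.

*Uniform gain* (`exists_uniform_gain`). Each subsystem satisfies its `Θ`-inequality or its `Ψ`- and
`Π`-inequalities, which leaves four cases. In each of them a nonnegative combination of the
available supply rates is, pointwise in time and along the loop equations, at most
`-(y₁² + y₂²) + C (w₁² + w₂²)`; integration yields the bound (`LoopBound.energy_le`). In the three
cases that involve `Θ₁` or `Θ₂`, the matrix inequalities provide this combination for `τ = 1`, and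
the sign conditions of finite gain extend it to all `τ` (`exists_loopBound_of_negDef`). In the
remaining case both subsystems are passive; the weights `1` and `τ` make the products `y₁ y₂`
cancel, `ε₂ < 0` gives `-τ u₂²`, and the two `Π`-inequalities, which bound the gains of the
subsystems, supply the rest (`exists_loopBound_of_passive`). All constants are independent of `τ`.

*Continuation* (`IsLoopStable.of_near`). If the loop with gain `τ` maps `L2` to `L2` and `τ'` is
close to `τ`, then `y₂` is fed back as the extra input `-(τ' - τ) y₂` of the loop with gain `τ`.
Causality allows this input to be truncated at `T`, the uniform gain bounds the energy of the
output on `[0, T]` by that of `w` independently of `T`, and the output is in `L2`. The admissible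
step depends on the uniform gain only, so that finitely many steps lead from `0` to `1`.
-/

/-! ### Quadratic forms in two variables -/

/-- The quadratic form `ξᵀ P ξ` at `ξ = (a, b)`, the integrand of `supply`. -/
def quad (P : Matrix (Fin 2) (Fin 2) ℝ) (a b : ℝ) : ℝ := ![a, b] ⬝ᵥ (P *ᵥ ![a, b])

lemma quad_eq (P : Matrix (Fin 2) (Fin 2) ℝ) (a b : ℝ) :
    quad P a b = P 0 0 * a ^ 2 + (P 0 1 + P 1 0) * (a * b) + P 1 1 * b ^ 2 := by
  simp [quad, Matrix.mulVec, dotProduct, Fin.sum_univ_two]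
  ring

lemma quad_add (P Q : Matrix (Fin 2) (Fin 2) ℝ) (a b : ℝ) :
    quad (P + Q) a b = quad P a b + quad Q a b := by
  simp only [quad_eq, Matrix.add_apply]
  ring

lemma quad_smul (c : ℝ) (P : Matrix (Fin 2) (Fin 2) ℝ) (a b : ℝ) :
    quad (c • P) a b = c * quad P a b := by
  simp only [quad_eq, Matrix.smul_apply, smul_eq_mul]
  ring

lemma quad_PsiMatrix (ε a b : ℝ) :
    quad (NonlinearSystem.PsiMatrix ε) a b = 2 * ε * a ^ 2 + 2 * (a * b) := by
  simp only [quad_eq, NonlinearSystem.PsiMatrix, of_apply, cons_val', cons_val_zero, cons_val_one,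
    cons_val_fin_one]
  ring

lemma quad_conj_loopMatrix (A : Matrix (Fin 2) (Fin 2) ℝ) (a b : ℝ) :
    quad (loopMatrixᵀ * A * loopMatrix) a b = quad A (-b) a := by
  simp [quad_eq, loopMatrix, Matrix.mul_apply, Fin.sum_univ_two]
  ring

lemma mul_le_weighted_sq {d : ℝ} (hd : 0 < d) (s a b : ℝ) :
    s * (a * b) ≤ d * b ^ 2 + s ^ 2 / (4 * d) * a ^ 2 := by
  have h : d * b ^ 2 + s ^ 2 / (4 * d) * a ^ 2 - s * (a * b) = d * (b - s / (2 * d) * a) ^ 2 := by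
    field_simp
    ring
  have := mul_nonneg hd.le (sq_nonneg (b - s / (2 * d) * a))
  linarith

lemma NegDef.exists_quad_le {P : Matrix (Fin 2) (Fin 2) ℝ} (h : NegDef P) :
    ∃ η > 0, ∀ a b, quad P a b ≤ -η * (a ^ 2 + b ^ 2) := by
  have hsymm : P 1 0 = P 0 1 := by
    have := h.isHermitian.apply 0 1
    simpa using this
  have h0 : P 0 0 < 0 := by simpa using h.diag_pos (i := 0)
  have h1 : P 1 1 < 0 := by simpa using h.diag_pos (i := 1)
  have hdet : 0 < P 0 0 * P 1 1 - P 0 1 ^ 2 := by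
    have := h.det_pos
    rw [Matrix.det_fin_two] at this
    simp only [Matrix.neg_apply, hsymm] at this
    nlinarith
  -- `η = det / trace` of `-P` bounds the smaller eigenvalue of `-P` from below.
  set α := -P 0 0 with hα
  set β := -P 1 1 with hβ
  set D := P 0 0 * P 1 1 - P 0 1 ^ 2 with hD
  have hαp : 0 < α := by linarith
  have hβp : 0 < β := by linarith
  have htr : 0 < α + β := by linarith
  refine ⟨D / (α + β), by positivity, fun a b => ?_⟩
  have hDe : D = α * β - P 0 1 ^ 2 := by rw [hD, hα, hβ]; ring
  rw [quad_eq, hsymm, show P 0 0 = -α by simp [hα], show P 1 1 = -β by simp [hβ]]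
  have key : (α + β) * (-α * a ^ 2 + (P 0 1 + P 0 1) * (a * b) + -β * b ^ 2)
      + D * (a ^ 2 + b ^ 2) = -(α * a - P 0 1 * b) ^ 2 - (β * b - P 0 1 * a) ^ 2 := by
    rw [hDe]; ring
  have : -α * a ^ 2 + (P 0 1 + P 0 1) * (a * b) + -β * b ^ 2
      ≤ -(D * (a ^ 2 + b ^ 2)) / (α + β) := by
    rw [le_div_iff₀ htr]
    nlinarith [sq_nonneg (α * a - P 0 1 * b), sq_nonneg (β * b - P 0 1 * a)]
  calc _ ≤ _ := this
    _ = _ := by ring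

lemma exists_quad_le_sub {B : Matrix (Fin 2) (Fin 2) ℝ} (hB : B 1 1 < 0) :
    ∃ c > 0, ∃ d > 0, ∀ a b, quad B a b ≤ c * a ^ 2 - d * b ^ 2 := by
  refine ⟨|B 0 0| + (B 0 1 + B 1 0) ^ 2 / (4 * (-B 1 1 / 2)) + 1, ?_, -B 1 1 / 2, by linarith,
    fun a b => ?_⟩
  · have : 0 ≤ (B 0 1 + B 1 0) ^ 2 / (4 * (-B 1 1 / 2)) :=
      div_nonneg (sq_nonneg _) (by linarith)
    positivity
  · rw [quad_eq]
    have h1 := mul_le_weighted_sq (d := -B 1 1 / 2) (by linarith) (B 0 1 + B 1 0) a b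
    have h2 := mul_le_mul_of_nonneg_right (le_abs_self (B 0 0)) (sq_nonneg a)
    nlinarith [sq_nonneg a]

/-- A form that is negative in its second variable becomes negative definite once it is scaled
down and a negative multiple of the square of the first variable is added. -/
lemma exists_smul_quad_le {m : ℝ} (hm : m < 0) {B : Matrix (Fin 2) (Fin 2) ℝ} (hB : B 1 1 < 0) :
    ∃ κ > 0, ∃ η > 0, ∀ a b, m * a ^ 2 + κ * quad B a b ≤ -η * (a ^ 2 + b ^ 2) := by
  obtain ⟨c, hc, d, hd, h⟩ := exists_quad_le_sub hB
  have hκ : 0 < -m / (2 * c) := div_pos (by linarith) (by linarith)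
  refine ⟨-m / (2 * c), hκ, min (-m / 2) (-m / (2 * c) * d),
    lt_min (by linarith) (mul_pos hκ hd), fun a b => ?_⟩
  have h1 := mul_le_mul_of_nonneg_left (h a b) hκ.le
  have h2 : -m / (2 * c) * (c * a ^ 2 - d * b ^ 2)
      = -m / 2 * a ^ 2 - -m / (2 * c) * d * b ^ 2 := by
    field_simp
    ring
  have h3 := mul_le_mul_of_nonneg_right (min_le_left (-m / 2) (-m / (2 * c) * d)) (sq_nonneg a)
  have h4 := mul_le_mul_of_nonneg_right (min_le_right (-m / 2) (-m / (2 * c) * d)) (sq_nonneg b)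
  linarith

lemma exists_quad_add_le (A : Matrix (Fin 2) (Fin 2) ℝ) {δ : ℝ} (hδ : 0 < δ) :
    ∃ C ≥ 0, ∀ p₁ p₂ r₁ r₂ : ℝ, quad A (p₁ + r₁) (p₂ + r₂)
      ≤ quad A p₁ p₂ + δ * (p₁ ^ 2 + p₂ ^ 2) + C * (r₁ ^ 2 + r₂ ^ 2) := by
  set s := A 0 1 + A 1 0 with hs
  have hd : 0 < δ / 2 := by linarith
  set e : ℝ → ℝ := fun x => x ^ 2 / (4 * (δ / 2)) with he
  have he0 : ∀ x, 0 ≤ e x := fun x => by positivity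
  refine ⟨|A 0 0| + |A 1 1| + |s| + e (2 * A 0 0) + e (2 * A 1 1) + e s, ?_,
    fun p₁ p₂ r₁ r₂ => ?_⟩
  · have := he0 (2 * A 0 0)
    have := he0 (2 * A 1 1)
    have := he0 s
    positivity
  have hexp : quad A (p₁ + r₁) (p₂ + r₂) = quad A p₁ p₂
      + (2 * A 0 0 * (r₁ * p₁) + s * (r₂ * p₁) + s * (r₁ * p₂) + 2 * A 1 1 * (r₂ * p₂))
      + (A 0 0 * r₁ ^ 2 + s * (r₁ * r₂) + A 1 1 * r₂ ^ 2) := by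
    simp only [quad_eq, hs]; ring
  have h1 : 2 * A 0 0 * (r₁ * p₁) ≤ δ / 2 * p₁ ^ 2 + e (2 * A 0 0) * r₁ ^ 2 :=
    mul_le_weighted_sq hd _ _ _
  have h2 : s * (r₂ * p₁) ≤ δ / 2 * p₁ ^ 2 + e s * r₂ ^ 2 := mul_le_weighted_sq hd _ _ _
  have h3 : s * (r₁ * p₂) ≤ δ / 2 * p₂ ^ 2 + e s * r₁ ^ 2 := mul_le_weighted_sq hd _ _ _
  have h4 : 2 * A 1 1 * (r₂ * p₂) ≤ δ / 2 * p₂ ^ 2 + e (2 * A 1 1) * r₂ ^ 2 :=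
    mul_le_weighted_sq hd _ _ _
  have h5 : s * (r₁ * r₂) ≤ |s| * (r₁ ^ 2 + r₂ ^ 2) := by
    calc s * (r₁ * r₂) ≤ |s| * |r₁ * r₂| := by rw [← abs_mul]; exact le_abs_self _
      _ ≤ _ := by
        refine mul_le_mul_of_nonneg_left ?_ (abs_nonneg s)
        rw [abs_le]
        constructor <;> nlinarith [sq_nonneg (r₁ + r₂), sq_nonneg (r₁ - r₂)]
  have h6 := mul_le_mul_of_nonneg_right (le_abs_self (A 0 0)) (sq_nonneg r₁)
  have h7 := mul_le_mul_of_nonneg_right (le_abs_self (A 1 1)) (sq_nonneg r₂)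
  have h8 := mul_nonneg (abs_nonneg (A 0 0)) (sq_nonneg r₂)
  have h9 := mul_nonneg (abs_nonneg (A 1 1)) (sq_nonneg r₁)
  have h10 := mul_nonneg (he0 (2 * A 0 0)) (sq_nonneg r₂)
  have h11 := mul_nonneg (he0 (2 * A 1 1)) (sq_nonneg r₁)
  rw [hexp]
  linarith

/-! ### Pointwise dissipation inequalities, uniform in the loop gain -/

/-- The pointwise inequality from which an `L2` gain bound follows: `P₁` and `P₂` are evaluated
at the input-output pairs `(w₁ - τ b, a - w₂)` and `(a, b)` of the two subsystems, where `a` and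
`b` stand for the values of `u₂` and `y₂`, so that `y₁ = a - w₂`. -/
def LoopBound (C τ : ℝ) (P₁ P₂ : Matrix (Fin 2) (Fin 2) ℝ) : Prop :=
  ∀ a b w₁ w₂ : ℝ, (a - w₂) ^ 2 + b ^ 2
    + (quad P₁ (w₁ - τ * b) (a - w₂) + quad P₂ a b) ≤ C * (w₁ ^ 2 + w₂ ^ 2)

/-- A strict inequality without external inputs is robust: the constants depend on `P₁` and `η`
only, neither on `τ` nor on `P₂`. -/
lemma exists_loopBound_of_quad_le (P₁ : Matrix (Fin 2) (Fin 2) ℝ) {η : ℝ} (hη : 0 < η) :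
    ∃ C ≥ 0, ∃ l ≥ (0 : ℝ), ∀ τ ∈ Icc (0 : ℝ) 1, ∀ P₂ : Matrix (Fin 2) (Fin 2) ℝ,
      (∀ a b, quad P₁ (-(τ * b)) a + quad P₂ a b ≤ -η * (a ^ 2 + b ^ 2)) →
      LoopBound C τ (l • P₁) (l • P₂) := by
  obtain ⟨C₀, hC₀, h⟩ := exists_quad_add_le P₁ (half_pos hη)
  refine ⟨4 / η * C₀ + 2, by positivity, 4 / η, by positivity,
    fun τ hτ P₂ hP a b w₁ w₂ => ?_⟩
  have h1 := h (-(τ * b)) a w₁ (-w₂)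
  rw [show -(τ * b) + w₁ = w₁ - τ * b by ring, ← sub_eq_add_neg] at h1
  have h2 := hP a b
  have h3 : (τ * b) ^ 2 ≤ b ^ 2 := by
    rw [mul_pow]
    exact mul_le_of_le_one_left (sq_nonneg b) (pow_le_one₀ hτ.1 hτ.2)
  have h4 : η / 2 * ((-(τ * b)) ^ 2 + a ^ 2) ≤ η / 2 * (a ^ 2 + b ^ 2) := by
    refine mul_le_mul_of_nonneg_left ?_ (half_pos hη).le
    rw [neg_sq]
    linarith
  have h5 : η / 2 * (a ^ 2 + b ^ 2) ≤ C₀ * (w₁ ^ 2 + w₂ ^ 2)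
      - (quad P₁ (w₁ - τ * b) (a - w₂) + quad P₂ a b) := by
    rw [neg_sq w₂] at h1
    linarith
  have h6 := mul_le_mul_of_nonneg_left h5 (show 0 ≤ 4 / η by positivity)
  rw [show 4 / η * (η / 2 * (a ^ 2 + b ^ 2)) = 2 * (a ^ 2 + b ^ 2) by field_simp; ring] at h6
  rw [quad_smul, quad_smul]
  nlinarith [sq_nonneg (a + w₂), sq_nonneg w₁, sq_nonneg b]

/-- Replacing `M` by `M_τ = [0, -τ; 1, 0]` keeps the negative definiteness of `Mᵀ A M + p B`,
provided that the multiplier `p` is adapted to `τ`. The sign conditions on `A` bound the form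
`M_τᵀ A M_τ` by the convex combination of `Mᵀ A M` and `A 1 1 * a ^ 2`; the latter is dealt with
by a small multiple of `B`. -/
lemma exists_loopBound_of_negDef {A B : Matrix (Fin 2) (Fin 2) ℝ} (hA0 : 0 ≤ A 0 0)
    (hA1 : A 1 1 < 0) {p : ℝ} (hp : 0 ≤ p) (hB : B 1 1 < 0)
    (h : NegDef (loopMatrixᵀ * A * loopMatrix + p • B)) :
    ∃ C ≥ 0, ∀ τ ∈ Icc (0 : ℝ) 1, ∃ l₁ ≥ (0 : ℝ), ∃ l₂ ≥ (0 : ℝ),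
      LoopBound C τ (l₁ • A) (l₂ • B) := by
  obtain ⟨η₁, hη₁, h1⟩ := h.exists_quad_le
  obtain ⟨κ, hκ, η₂, hη₂, h2⟩ := exists_smul_quad_le hA1 hB
  obtain ⟨C, hC, l, hl, hb⟩ := exists_loopBound_of_quad_le A (lt_min hη₁ hη₂)
  refine ⟨C, hC, fun τ hτ => ⟨l, hl, l * (τ * p + (1 - τ) * κ), ?_, ?_⟩⟩
  · have h0 : 0 ≤ 1 - τ := sub_nonneg.2 hτ.2
    have := hτ.1
    positivity
  rw [← smul_smul]
  refine hb τ hτ _ fun a b => ?_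
  have h3 := mul_le_mul_of_nonneg_left (h1 a b) hτ.1
  have h4 := mul_le_mul_of_nonneg_left (h2 a b) (sub_nonneg.2 hτ.2)
  have hs := add_nonneg (sq_nonneg a) (sq_nonneg b)
  have h5 := mul_le_mul_of_nonneg_left
    (mul_le_mul_of_nonneg_right (min_le_left η₁ η₂) hs) hτ.1
  have h6 := mul_le_mul_of_nonneg_left
    (mul_le_mul_of_nonneg_right (min_le_right η₁ η₂) hs) (sub_nonneg.2 hτ.2)
  rw [quad_add, quad_conj_loopMatrix, quad_smul, quad_eq A] at h3
  rw [quad_smul, quad_eq A]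
  have h7 : 0 ≤ A 0 0 * (τ * (1 - τ)) * b ^ 2 :=
    mul_nonneg (mul_nonneg hA0 (mul_nonneg hτ.1 (sub_nonneg.2 hτ.2))) (sq_nonneg b)
  linarith

/-- The second diagonal entry of `Mᵀ A M + p B` is `A 0 0 + p * B 1 1`. -/
lemma NegDef.apply_one_one_neg {A B : Matrix (Fin 2) (Fin 2) ℝ} (hA0 : 0 ≤ A 0 0)
    {p : ℝ} (hp : 0 ≤ p) (h : NegDef (loopMatrixᵀ * A * loopMatrix + p • B)) : B 1 1 < 0 := by
  obtain ⟨η, hη, hq⟩ := h.exists_quad_le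
  have h1 := hq 0 1
  rw [quad_add, quad_conj_loopMatrix, quad_smul, quad_eq, quad_eq] at h1
  norm_num at h1
  by_contra! hB
  nlinarith [mul_nonneg hp hB]

/-- The case in which both subsystems are passive with finite gain. In the sum of the two passivity
inequalities, the second one weighted by `τ`, the cross terms `y₁ y₂` cancel, which leaves
at most `2 τ ε₂ a ^ 2` when `w = 0`. The two gain inequalities take care of `τ` near `0`. -/
lemma exists_loopBound_of_passive {A B : Matrix (Fin 2) (Fin 2) ℝ} (hA1 : A 1 1 < 0)
    (hB : B 1 1 < 0) {ε₁ ε₂ : ℝ} (hε₁ : ε₁ ≤ 0) (hε₂ : ε₂ < 0) :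
    ∃ C ≥ 0, ∀ τ ∈ Icc (0 : ℝ) 1, ∃ k₁ ≥ (0 : ℝ), ∃ l₁ ≥ (0 : ℝ), ∃ k₂ ≥ (0 : ℝ), ∃ l₂ ≥ (0 : ℝ),
      LoopBound C τ (k₁ • NonlinearSystem.PsiMatrix ε₁ + l₁ • A)
        (k₂ • NonlinearSystem.PsiMatrix ε₂ + l₂ • B) := by
  obtain ⟨κ, hκ, η, hη, h1⟩ := exists_smul_quad_le hA1 hB
  obtain ⟨c, hc, d, hd, h2⟩ := exists_quad_le_sub hB
  set s := A 0 1 + A 1 0 with hs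
  -- The terms of `A` that carry a factor `τ` are at most `τ * (|A 0 0| b ^ 2 - s a b)`: the
  -- multiple `μ` of `B` dominates their part in `b`, then the multiple `k` of the passivity
  -- inequalities dominates what is left in `a`.
  set μ := (|A 0 0| + 1) / d with hμ
  have hμ0 : 0 < μ := by positivity
  set k := (μ * c + s ^ 2 / 4) / (-2 * ε₂) with hk
  have hε : 0 < -2 * ε₂ := by linarith
  have hk0 : 0 ≤ k := by positivity
  obtain ⟨C, hC, l, hl, hb⟩ :=
    exists_loopBound_of_quad_le (k • NonlinearSystem.PsiMatrix ε₁ + A) hη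
  refine ⟨C, hC, fun τ hτ => ⟨l * k, by positivity, l, hl, l * (τ * k), ?_,
    l * (κ + τ * μ), ?_, ?_⟩⟩
  · have := hτ.1
    positivity
  · have := hτ.1
    positivity
  rw [mul_smul l k, mul_smul l (τ * k), mul_smul l (κ + τ * μ), ← smul_add, ← smul_add]
  refine hb τ hτ _ fun a b => ?_
  rw [quad_add, quad_smul, quad_PsiMatrix, quad_add, quad_smul, quad_smul, quad_PsiMatrix,
    quad_eq A]
  have e1 : k * (-2 * ε₂) = μ * c + s ^ 2 / 4 := div_mul_cancel₀ _ hε.ne'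
  have e2 : μ * d = |A 0 0| + 1 := div_mul_cancel₀ _ hd.ne'
  have h3 : s * (-(a * b)) ≤ b ^ 2 + s ^ 2 / 4 * a ^ 2 := by
    nlinarith [sq_nonneg (b + s / 2 * a)]
  have h4 := mul_le_mul_of_nonneg_left (h2 a b) hμ0.le
  have h5 : A 0 0 * τ * b ^ 2 ≤ |A 0 0| * b ^ 2 := by
    refine mul_le_mul_of_nonneg_right ?_ (sq_nonneg b)
    calc A 0 0 * τ ≤ |A 0 0| * τ := mul_le_mul_of_nonneg_right (le_abs_self _) hτ.1
      _ ≤ |A 0 0| := mul_le_of_le_one_right (abs_nonneg _) hτ.2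
  have h6 : k * (2 * ε₂) * a ^ 2 + μ * quad B a b + A 0 0 * τ * b ^ 2 + s * (-(a * b)) ≤ 0 := by
    linear_combination h3 + h4 + h5 - a ^ 2 * e1 - b ^ 2 * e2
  have h7 := mul_nonpos_of_nonneg_of_nonpos hτ.1 h6
  have h8 : k * (2 * ε₁ * (-(τ * b)) ^ 2) ≤ 0 :=
    mul_nonpos_of_nonneg_of_nonpos hk0
      (mul_nonpos_of_nonpos_of_nonneg (by linarith) (sq_nonneg _))
  have h9 := h1 a b
  linarith

/-! ### Integration of the pointwise inequalities -/

lemma IsL2.integrableOn_mul {u v : ℝ → ℝ} (hu : IsL2 u) (hv : IsL2 v) :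
    IntegrableOn (fun t => u t * v t) (Ici 0) :=
  MemLp.integrable_mul (p := 2) (q := 2) hu hv

lemma IsL2.integrableOn_sq {u : ℝ → ℝ} (hu : IsL2 u) :
    IntegrableOn (fun t => u t ^ 2) (Ici 0) :=
  MemLp.integrable_sq hu

lemma IsL2.integrableOn_quad {u y : ℝ → ℝ} (P : Matrix (Fin 2) (Fin 2) ℝ) (hu : IsL2 u)
    (hy : IsL2 y) : IntegrableOn (fun t => quad P (u t) (y t)) (Ici 0) := by
  simp only [quad_eq]
  exact ((hu.integrableOn_sq.const_mul _).add ((hu.integrableOn_mul hy).const_mul _)).add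
    (hy.integrableOn_sq.const_mul _)

lemma supply_smul (c : ℝ) (P : Matrix (Fin 2) (Fin 2) ℝ) (u y : ℝ → ℝ) :
    supply (c • P) u y = c * supply P u y := by
  change ∫ t in Ici (0 : ℝ), quad (c • P) (u t) (y t) = c * ∫ t in Ici (0 : ℝ), quad P (u t) (y t)
  simp only [quad_smul]
  exact integral_const_mul _ _

lemma supply_add (P Q : Matrix (Fin 2) (Fin 2) ℝ) {u y : ℝ → ℝ} (hu : IsL2 u) (hy : IsL2 y) :
    supply (P + Q) u y = supply P u y + supply Q u y := by
  change ∫ t in Ici (0 : ℝ), quad (P + Q) (u t) (y t)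
    = (∫ t in Ici (0 : ℝ), quad P (u t) (y t)) + ∫ t in Ici (0 : ℝ), quad Q (u t) (y t)
  simp only [quad_add]
  exact integral_add (hu.integrableOn_quad P hy) (hu.integrableOn_quad Q hy)

/-- The squared `L2` norm on `[0, ∞)` of the signal `(a, b)`, the square of `pairNorm`. -/
noncomputable def energy (a b : ℝ → ℝ) : ℝ := ∫ t in Ici (0 : ℝ), (a t ^ 2 + b t ^ 2)

lemma energy_nonneg (a b : ℝ → ℝ) : 0 ≤ energy a b :=
  integral_nonneg fun _ => by positivity

lemma LoopBound.energy_le {C τ : ℝ} {P₁ P₂ : Matrix (Fin 2) (Fin 2) ℝ} (h : LoopBound C τ P₁ P₂)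
    {w₁ w₂ y₁ y₂ : ℝ → ℝ} (hw₁ : IsL2 w₁) (hw₂ : IsL2 w₂) (hy₁ : IsL2 y₁) (hy₂ : IsL2 y₂) :
    energy y₁ y₂ + (supply P₁ (fun t => w₁ t - τ * y₂ t) y₁ + supply P₂ (fun t => w₂ t + y₁ t) y₂)
      ≤ C * energy w₁ w₂ := by
  have hu₁ : IsL2 (fun t => w₁ t - τ * y₂ t) := MemLp.sub hw₁ (MemLp.const_mul hy₂ τ)
  have hu₂ : IsL2 (fun t => w₂ t + y₁ t) := MemLp.add hw₂ hy₁
  have i1 := hu₁.integrableOn_quad P₁ hy₁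
  have i2 := hu₂.integrableOn_quad P₂ hy₂
  have i3 := hy₁.integrableOn_sq.add hy₂.integrableOn_sq
  have hle : ∫ t in Ici (0 : ℝ), (y₁ t ^ 2 + y₂ t ^ 2 + (quad P₁ (w₁ t - τ * y₂ t) (y₁ t)
      + quad P₂ (w₂ t + y₁ t) (y₂ t))) ≤ ∫ t in Ici (0 : ℝ), C * (w₁ t ^ 2 + w₂ t ^ 2) := by
    refine integral_mono (i3.add (i1.add i2))
      ((hw₁.integrableOn_sq.add hw₂.integrableOn_sq).const_mul C) fun t => ?_
    simpa using h (w₂ t + y₁ t) (y₂ t) (w₁ t) (w₂ t)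
  have e1 := integral_add i3 (i1.add i2)
  have e2 := integral_add i1 i2
  have e3 : ∫ t in Ici (0 : ℝ), C * (w₁ t ^ 2 + w₂ t ^ 2) = C * energy w₁ w₂ :=
    integral_const_mul _ _
  simp only [Pi.add_apply] at e1 e2
  rw [e1, e2, e3] at hle
  exact hle

/-- All square-integrable responses of the loops with gain `τ ∈ [0, 1]` satisfy one and the same
gain bound. -/
theorem exists_uniform_gain {S₁ S₂ : NonlinearSystem}
    {Θ₁ Pi₁ Θ₂ Pi₂ : Matrix (Fin 2) (Fin 2) ℝ} {ε₁ ε₂ : ℝ} (hε₁ : ε₁ ≤ 0) (hε₂ : ε₂ < 0)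
    (h₁ : S₁.IsFiniteGainMixedDissipative Θ₁ Pi₁ ε₁) (h₂ : S₂.IsMixedDissipative Θ₂ Pi₂ ε₂)
    {p₁ p₂ p₃ : ℝ} (hp₁ : 0 ≤ p₁) (hp₂ : 0 ≤ p₂) (hp₃ : 0 ≤ p₃)
    (hn₁ : NegDef (loopMatrixᵀ * Θ₁ * loopMatrix + p₁ • Pi₂))
    (hn₂ : NegDef (loopMatrixᵀ * Pi₁ * loopMatrix + p₂ • Θ₂))
    (hn₃ : NegDef (loopMatrixᵀ * Θ₁ * loopMatrix + p₃ • Θ₂)) :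
    ∃ Γ > 0, ∀ τ ∈ Icc (0 : ℝ) 1, ∀ w₁ w₂ y₁ y₂ : ℝ → ℝ, IsL2 w₁ → IsL2 w₂ → IsL2 y₁ → IsL2 y₂ →
      IsClosedLoopOutput S₁ S₂ τ w₁ w₂ y₁ y₂ → energy y₁ y₂ ≤ Γ * energy w₁ w₂ := by
  obtain ⟨⟨-, -, hd₁⟩, ⟨hΘ0, hΘ1⟩, hPi0, hPi1⟩ := h₁
  obtain ⟨-, -, hd₂⟩ := h₂
  have hPi₂ : Pi₂ 1 1 < 0 := hn₁.apply_one_one_neg hΘ0 hp₁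
  have hΘ₂ : Θ₂ 1 1 < 0 := hn₃.apply_one_one_neg hΘ0 hp₃
  obtain ⟨C₁, hC₁, b₁⟩ := exists_loopBound_of_negDef hΘ0 hΘ1 hp₁ hPi₂ hn₁
  obtain ⟨C₂, hC₂, b₂⟩ := exists_loopBound_of_negDef hPi0 hPi1 hp₂ hΘ₂ hn₂
  obtain ⟨C₃, hC₃, b₃⟩ := exists_loopBound_of_negDef hΘ0 hΘ1 hp₃ hΘ₂ hn₃
  obtain ⟨C₄, hC₄, b₄⟩ := exists_loopBound_of_passive hPi1 hPi₂ hε₁ hε₂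
  refine ⟨C₁ + C₂ + C₃ + C₄ + 1, by linarith, fun τ hτ w₁ w₂ y₁ y₂ hw₁ hw₂ hy₁ hy₂ hcl => ?_⟩
  obtain ⟨-, -, io₁, io₂⟩ := hcl
  have hu₁ : IsL2 (fun t => w₁ t - τ * y₂ t) := MemLp.sub hw₁ (MemLp.const_mul hy₂ τ)
  have hu₂ : IsL2 (fun t => w₂ t + y₁ t) := MemLp.add hw₂ hy₁
  have hE := energy_nonneg w₁ w₂
  have hE₁ := mul_nonneg hC₁ hE
  have hE₂ := mul_nonneg hC₂ hE
  have hE₃ := mul_nonneg hC₃ hE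
  have hE₄ := mul_nonneg hC₄ hE
  rcases hd₁ _ _ hu₁ hy₁ io₁ with q₁ | ⟨q₁, r₁⟩ <;>
    rcases hd₂ _ _ hu₂ hy₂ io₂ with q₂ | ⟨q₂, r₂⟩
  · obtain ⟨l₁, hl₁, l₂, hl₂, hb⟩ := b₃ τ hτ
    have := hb.energy_le hw₁ hw₂ hy₁ hy₂
    rw [supply_smul, supply_smul] at this
    linarith [mul_nonneg hl₁ q₁, mul_nonneg hl₂ q₂]
  · obtain ⟨l₁, hl₁, l₂, hl₂, hb⟩ := b₁ τ hτ
    have := hb.energy_le hw₁ hw₂ hy₁ hy₂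
    rw [supply_smul, supply_smul] at this
    linarith [mul_nonneg hl₁ q₁, mul_nonneg hl₂ r₂]
  · obtain ⟨l₁, hl₁, l₂, hl₂, hb⟩ := b₂ τ hτ
    have := hb.energy_le hw₁ hw₂ hy₁ hy₂
    rw [supply_smul, supply_smul] at this
    linarith [mul_nonneg hl₁ r₁, mul_nonneg hl₂ q₂]
  · obtain ⟨k₁, hk₁, l₁, hl₁, k₂, hk₂, l₂, hl₂, hb⟩ := b₄ τ hτ
    have := hb.energy_le hw₁ hw₂ hy₁ hy₂
    rw [supply_add _ _ hu₁ hy₁, supply_add _ _ hu₂ hy₂, supply_smul, supply_smul, supply_smul,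
      supply_smul] at this
    linarith [mul_nonneg hk₁ q₁, mul_nonneg hl₁ r₁, mul_nonneg hk₂ q₂, mul_nonneg hl₂ r₂]

/-! ### Truncation and continuation in the loop gain -/

lemma IsL2.isL2e {u : ℝ → ℝ} (hu : IsL2 u) : IsL2e u := fun _ _ =>
  MemLp.mono_measure (Measure.restrict_mono Icc_subset_Ici_self le_rfl) hu

lemma IsL2e.isL2_indicator {u : ℝ → ℝ} (hu : IsL2e u) {T : ℝ} (hT : 0 ≤ T) :
    IsL2 ((Icc 0 T).indicator u) := by
  rw [IsL2, memLp_indicator_iff_restrict measurableSet_Icc,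
    Measure.restrict_restrict measurableSet_Icc, inter_eq_left.2 Icc_subset_Ici_self]
  exact hu T hT

lemma agreeUpTo_indicator (T : ℝ) (u : ℝ → ℝ) : AgreeUpTo T u ((Icc 0 T).indicator u) := by
  refine (ae_restrict_mem measurableSet_Icc).mono fun t ht => ?_
  rw [indicator_of_mem ht]

lemma IsL2e.integrableOn_Icc_sq {u : ℝ → ℝ} (hu : IsL2e u) {T : ℝ} (hT : 0 ≤ T) :
    IntegrableOn (fun t => u t ^ 2) (Icc 0 T) :=
  MemLp.integrable_sq (hu T hT)

/-- The energy of the signal `(a, b)` on `[0, T]`. -/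
noncomputable def energyUpTo (T : ℝ) (a b : ℝ → ℝ) : ℝ := ∫ t in Icc (0 : ℝ) T, (a t ^ 2 + b t ^ 2)

lemma energy_indicator (T : ℝ) (a b : ℝ → ℝ) :
    energy ((Icc 0 T).indicator a) ((Icc 0 T).indicator b) = energyUpTo T a b := by
  have h : ∀ t, (Icc 0 T).indicator a t ^ 2 + (Icc 0 T).indicator b t ^ 2
      = (Icc 0 T).indicator (fun t => a t ^ 2 + b t ^ 2) t := fun t => by
    by_cases ht : t ∈ Icc 0 T <;> simp [ht]
  simp only [energy, energyUpTo, h]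
  rw [setIntegral_indicator measurableSet_Icc, inter_eq_right.2 Icc_subset_Ici_self]

lemma energyUpTo_le_energy {a b : ℝ → ℝ} (ha : IsL2 a) (hb : IsL2 b) (T : ℝ) :
    energyUpTo T a b ≤ energy a b :=
  setIntegral_mono_set (ha.integrableOn_sq.add hb.integrableOn_sq)
    (Filter.Eventually.of_forall fun _ => by positivity) Icc_subset_Ici_self.eventuallyLE

lemma energyUpTo_congr {T : ℝ} {a b c d : ℝ → ℝ} (h : AgreeUpTo T a c) (h' : AgreeUpTo T b d) :
    energyUpTo T a b = energyUpTo T c d := by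
  refine integral_congr_ae ?_
  filter_upwards [h, h'] with t h1 h2
  rw [h1, h2]

lemma isL2_of_forall_integral_le {u : ℝ → ℝ} (hu : IsL2e u) (K : ℝ)
    (h : ∀ T, 0 ≤ T → ∫ t in Icc (0 : ℝ) T, u t ^ 2 ≤ K) : IsL2 u := by
  have hU : (⋃ n : ℕ, Icc (0 : ℝ) n) = Ici 0 := by
    ext t
    simp only [mem_iUnion, mem_Icc, mem_Ici, exists_and_left, and_iff_left_iff_imp]
    exact fun _ => exists_nat_ge t
  have hm : AEStronglyMeasurable u (volume.restrict (Ici (0 : ℝ))) := by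
    rw [← hU, aestronglyMeasurable_iUnion_iff]
    exact fun n => (hu n n.cast_nonneg).aestronglyMeasurable
  rw [IsL2, memLp_two_iff_integrable_sq hm]
  have hcover : AECover (volume.restrict (Ici (0 : ℝ))) Filter.atTop
      (fun n : ℕ => Icc (0 : ℝ) n) := by
    refine ⟨?_, fun n => measurableSet_Icc⟩
    filter_upwards [ae_restrict_mem measurableSet_Ici] with t ht
    filter_upwards [Filter.eventually_ge_atTop ⌈t⌉₊] with n hn
    exact ⟨ht, Nat.ceil_le.1 hn⟩
  have hr : ∀ n : ℕ, (volume.restrict (Ici (0 : ℝ))).restrict (Icc (0 : ℝ) n)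
      = volume.restrict (Icc (0 : ℝ) n) := fun n => by
    rw [Measure.restrict_restrict measurableSet_Icc, inter_eq_left.2 Icc_subset_Ici_self]
  refine hcover.integrable_of_integral_norm_bounded K (fun n => ?_)
    (Filter.Eventually.of_forall fun n => ?_)
  · rw [IntegrableOn, hr]
    exact hu.integrableOn_Icc_sq n.cast_nonneg
  · rw [hr]
    simpa using h n n.cast_nonneg

/-- The loop with gain `τ` maps square-integrable inputs to square-integrable outputs. -/
def IsLoopStable (S₁ S₂ : NonlinearSystem) (τ : ℝ) : Prop :=
  ∀ w₁ w₂ y₁ y₂ : ℝ → ℝ, IsL2 w₁ → IsL2 w₂ → IsClosedLoopOutput S₁ S₂ τ w₁ w₂ y₁ y₂ →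
    IsL2 y₁ ∧ IsL2 y₂

lemma isLoopStable_zero {S₁ S₂ : NonlinearSystem} (h₁ : S₁.IsL2Stable) (h₂ : S₂.IsL2Stable) :
    IsLoopStable S₁ S₂ 0 := by
  rintro w₁ w₂ y₁ y₂ hw₁ hw₂ ⟨-, -, ⟨x₁, hx₁, ho₁⟩, x₂, hx₂, ho₂⟩
  have hy₁ : IsL2 y₁ := (h₁ _ _ _ (by simpa using hw₁) hx₁ ho₁).2
  exact ⟨hy₁, (h₂ _ _ _ (MemLp.add hw₂ hy₁) hx₂ ho₂).2⟩

/-- Stability carries over from the gain `τ` to a nearby gain `τ'`, at a distance that depends on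
the gain bound only. On `[0, T]`, an output of the loop with gain `τ'` is an output of the loop
with gain `τ` for the truncation of the external input `w₁ - (τ' - τ) y₂`, so that a small gain
argument bounds its energy on `[0, T]` independently of `T`. -/
lemma IsLoopStable.of_near {S₁ S₂ : NonlinearSystem} {τ τ' Γ : ℝ} (hΓ : 0 < Γ)
    (hwp : IsWellPosed S₁ S₂ τ)
    (hgain : ∀ w₁ w₂ y₁ y₂ : ℝ → ℝ, IsL2 w₁ → IsL2 w₂ → IsL2 y₁ → IsL2 y₂ →
      IsClosedLoopOutput S₁ S₂ τ w₁ w₂ y₁ y₂ → energy y₁ y₂ ≤ Γ * energy w₁ w₂)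
    (hδ : 4 * Γ * (τ' - τ) ^ 2 ≤ 1) (hst : IsLoopStable S₁ S₂ τ) : IsLoopStable S₁ S₂ τ' := by
  intro w₁ w₂ y₁ y₂ hw₁ hw₂ hcl
  have hy₁ := hcl.1
  have hy₂ := hcl.2.1
  set v : ℝ → ℝ := fun t => w₁ t - (τ' - τ) * y₂ t with hv
  have hvL : IsL2e v := fun T hT =>
    MemLp.sub (hw₁.isL2e T hT) (MemLp.const_mul (hy₂ T hT) (τ' - τ))
  have hcl' : IsClosedLoopOutput S₁ S₂ τ v w₂ y₁ y₂ := by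
    refine ⟨hy₁, hy₂, ?_, hcl.2.2.2⟩
    convert hcl.2.2.1 using 2
    simp only [hv]
    ring
  have hbound : ∀ T, 0 ≤ T → energyUpTo T y₁ y₂ ≤ 4 * Γ * energy w₁ w₂ := by
    intro T hT
    have hv1 := hvL.isL2_indicator hT
    have hv2 := hw₂.isL2e.isL2_indicator hT
    obtain ⟨z₁, z₂, hz, ha₁, ha₂⟩ := hwp.2 T hT _ _ _ _ _ _ hvL hw₂.isL2e hv1.isL2e hv2.isL2e
      (agreeUpTo_indicator T _) (agreeUpTo_indicator T _) hcl'
    obtain ⟨hz₁, hz₂⟩ := hst _ _ _ _ hv1 hv2 hz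
    have h1 := hgain _ _ _ _ hv1 hv2 hz₁ hz₂ hz
    have h2 := energyUpTo_le_energy hz₁ hz₂ T
    rw [← energyUpTo_congr ha₁ ha₂] at h2
    rw [energy_indicator] at h1
    have iw := (hw₁.isL2e.integrableOn_Icc_sq hT).add (hw₂.isL2e.integrableOn_Icc_sq hT)
    have iy := (hy₁.integrableOn_Icc_sq hT).add (hy₂.integrableOn_Icc_sq hT)
    have h3 : energyUpTo T v w₂
        ≤ 2 * energyUpTo T w₁ w₂ + 2 * (τ' - τ) ^ 2 * energyUpTo T y₁ y₂ := by
      have e1 := integral_add (iw.const_mul 2) (iy.const_mul (2 * (τ' - τ) ^ 2))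
      rw [integral_const_mul, integral_const_mul] at e1
      refine le_of_le_of_eq ?_ e1
      refine integral_mono ((hvL.integrableOn_Icc_sq hT).add (hw₂.isL2e.integrableOn_Icc_sq hT))
        ((iw.const_mul 2).add (iy.const_mul (2 * (τ' - τ) ^ 2))) fun t => ?_
      simp only [hv, Pi.add_apply]
      nlinarith [sq_nonneg (w₁ t + (τ' - τ) * y₂ t), sq_nonneg (w₂ t),
        sq_nonneg ((τ' - τ) * y₁ t)]
    have h4 := energyUpTo_le_energy hw₁ hw₂ T
    have h5 : 0 ≤ energyUpTo T y₁ y₂ := integral_nonneg fun _ => by positivity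
    have h6 := mul_le_mul_of_nonneg_left h3 hΓ.le
    have h7 := mul_le_mul_of_nonneg_left h4 hΓ.le
    have h8 := mul_le_mul_of_nonneg_right hδ h5
    linarith
  constructor
  · refine isL2_of_forall_integral_le hy₁ _ fun T hT => le_trans ?_ (hbound T hT)
    exact integral_mono (hy₁.integrableOn_Icc_sq hT)
      ((hy₁.integrableOn_Icc_sq hT).add (hy₂.integrableOn_Icc_sq hT)) fun t => by
        simpa using sq_nonneg (y₂ t)
  · refine isL2_of_forall_integral_le hy₂ _ fun T hT => le_trans ?_ (hbound T hT)
    exact integral_mono (hy₂.integrableOn_Icc_sq hT)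
      ((hy₁.integrableOn_Icc_sq hT).add (hy₂.integrableOn_Icc_sq hT)) fun t => by
        simpa using sq_nonneg (y₁ t)

theorem theorem2 (S₁ S₂ : NonlinearSystem)
    (hex₁ : S₁.HasGlobalSolutions) (hex₂ : S₂.HasGlobalSolutions)
    (hst₁ : S₁.IsL2Stable) (hst₂ : S₂.IsL2Stable)
    (Θ₁ Pi₁ Θ₂ Pi₂ : Matrix (Fin 2) (Fin 2) ℝ) (ε₁ ε₂ : ℝ)
    (hε₁ : ε₁ ≤ 0) (hε₂ : ε₂ < 0)
    (h₁ : S₁.IsFiniteGainMixedDissipative Θ₁ Pi₁ ε₁)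
    (h₂ : S₂.IsMixedDissipative Θ₂ Pi₂ ε₂)
    (hwp : ∀ τ ∈ Set.Icc (0 : ℝ) 1, IsWellPosed S₁ S₂ τ)
    (hp : ∃ p₁ p₂ p₃ : ℝ, 0 ≤ p₁ ∧ 0 ≤ p₂ ∧ 0 ≤ p₃ ∧
      NegDef (loopMatrixᵀ * Θ₁ * loopMatrix + p₁ • Pi₂) ∧
      NegDef (loopMatrixᵀ * Pi₁ * loopMatrix + p₂ • Θ₂) ∧
      NegDef (loopMatrixᵀ * Θ₁ * loopMatrix + p₃ • Θ₂)) :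
    ∃ γ : ℝ, 0 < γ ∧ ∀ w₁ w₂ : ℝ → ℝ, IsL2 w₁ → IsL2 w₂ →
      (∃ y₁ y₂, IsClosedLoopOutput S₁ S₂ 1 w₁ w₂ y₁ y₂) ∧
      ∀ y₁ y₂ : ℝ → ℝ, IsClosedLoopOutput S₁ S₂ 1 w₁ w₂ y₁ y₂ →
        IsL2 y₁ ∧ IsL2 y₂ ∧ pairNorm y₁ y₂ ≤ γ * pairNorm w₁ w₂ := by
  obtain ⟨p₁, p₂, p₃, hp₁, hp₂, hp₃, hn₁, hn₂, hn₃⟩ := hp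
  obtain ⟨Γ, hΓ, hgain⟩ := exists_uniform_gain hε₁ hε₂ h₁ h₂ hp₁ hp₂ hp₃ hn₁ hn₂ hn₃
  -- Steps of length `1 / N` are admissible: `4 Γ / N ^ 2 ≤ 1` as soon as `4 Γ ≤ N` and `1 ≤ N`.
  obtain ⟨N, hN⟩ := exists_nat_ge (4 * Γ)
  have hN0 : (0 : ℝ) < N := by linarith
  have hN1 : (1 : ℝ) ≤ N := by exact_mod_cast Nat.one_le_iff_ne_zero.2 (by rintro rfl; simp at hN0)
  have hst : ∀ k : ℕ, k ≤ N → IsLoopStable S₁ S₂ (k / N) := by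
    intro k
    induction k with
    | zero => intro _; simpa using isLoopStable_zero hst₁ hst₂
    | succ k ih =>
      intro hk
      have hmem : (k / N : ℝ) ∈ Set.Icc (0 : ℝ) 1 :=
        ⟨by positivity, (div_le_one hN0).2 (by exact_mod_cast (Nat.le_succ k).trans hk)⟩
      refine (ih (by omega)).of_near hΓ (hwp _ hmem) (hgain _ hmem) ?_
      have : (((k + 1 : ℕ) : ℝ) / N - k / N) = 1 / N := by push_cast; ring
      rw [this, one_div, inv_pow, ← div_eq_mul_inv, div_le_one (by positivity)]
      nlinarith
  have hst1 : IsLoopStable S₁ S₂ 1 := by simpa [hN0.ne'] using hst N le_rfl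
  have hmem : (1 : ℝ) ∈ Set.Icc (0 : ℝ) 1 := ⟨zero_le_one, le_rfl⟩
  refine ⟨Real.sqrt Γ, Real.sqrt_pos.2 hΓ, fun w₁ w₂ hw₁ hw₂ =>
    ⟨(hwp 1 hmem).1 w₁ w₂ hw₁.isL2e hw₂.isL2e, fun y₁ y₂ hcl => ?_⟩⟩
  obtain ⟨hy₁, hy₂⟩ := hst1 _ _ _ _ hw₁ hw₂ hcl
  refine ⟨hy₁, hy₂, ?_⟩
  have h := Real.sqrt_le_sqrt (hgain 1 hmem _ _ _ _ hw₁ hw₂ hy₁ hy₂ hcl)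
  rwa [Real.sqrt_mul hΓ.le] at h
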